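/- **Setting.** Let $d,T,m,n$ be positive integers with $m$ even. Let $\mathcal X$ be the set of $X=(X_1,\dots,X_T)\in\mathbb R^{d\times T}$ with $\|X_t\|_2\le 1$ for all $t$, let $X\mapsto q_X\in\mathbb R^d$ be a fixed map with $\|q_X\|_2\le 1$ for all $X\in\mathcal X$, and let $X^{(1)},\dots,X^{(n)}\in\mathcal X$ be fixed. Let $\sigma:\mathbb R\to\mathbb R$ be twice differentiable with $|\sigma|\le\sigma_0$, $|\sigma'|\le\sigma_1$, $|\sigma''|\le\sigma_2$. Write $\sigma_s$ for the softmax on $\mathbb R^T$, $J_s(z)=\operatorname{diag}(\sigma_s(z))-\sigma_s(z)\sigma_s(z)^\top$ for its Jacobian matrix, $\langle A,B\rangle_F=\operatorname{tr}(A^\top B)$, and $$a(X;W)=X\sigma_s(X^\top Wq_X),\qquad M(X;W)=X\,J_s(X^\top Wq_X)\,X^\top .$$ For $\varphi=(\varphi_i)_{i=1}^m$ with $\varphi_i=(c_i,U_i,\operatorname{vec}(W_i))\in\mathbb R^{1+d+d^2}$, the model is $$f(X;\varphi)=\frac1{\sqrt m}\sum_{i=1}^m c_i\,\sigma\big(U_i^\top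 a(X;W_i)\big).$$ **Initialization.** The random parameters $\varphi^{(0)}$ are drawn as follows: for $i\le m/2$, $c^{(0)}_i$ is uniform on $\{-1,1\}$, $U^{(0)}_i\sim\mathcal N(0,I_d)$, $W^{(0)}_i$ has i.i.d. $\mathcal N(0,1)$ entries, and all these draws are mutually independent; moreover $(c^{(0)}_{i+m/2},U^{(0)}_{i+m/2},W^{(0)}_{i+m/2})=(-c^{(0)}_i,U^{(0)}_i,W^{(0)}_i)$. The linearized model is $$f_{\mathrm{lin}}(X;\varphi)=f(X;\varphi^{(0)})+\big\langle\nabla_\varphi f(X;\varphi^{(0)}),\varphi-\varphi^{(0)}\big\rangle .$$ **Target class.** Let $v=(v_c,v_u,v_w):\mathbb R^{1+d+d^2}\to\mathbb R\times\mathbb R^d\times\mathbb R^{d\times d}$ be measurable (and deterministic) with $\sup|v_c|\le\bar\nu_c$, $\sup\|v_u\|_2\le\bar\nu_u$, $\sup\|v_w\|_F\le\bar\nu_w$. With $\varphi_0=(c,U,\operatorname{vec}(W))$ distributed as $\varphi^{(0)}_1$, $a=a(X;W)$ and $M=M(X;W)$, put $$\tilde f(X;v)=\mathbb E\big[\sigma(U^\top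 a)\,v_c(\varphi_0)\big]+\mathbb E\big[\sigma'(U^\top a)\langle a,v_u(\varphi_0)\rangle\big]+\mathbb E\big[\sigma'(U^\top a)\langle (MU)q_X^\top,v_w(\varphi_0)\rangle_F\big],$$ and let $\tilde\varphi=(\tilde c_i,\tilde U_i,\operatorname{vec}(\tilde W_i))_{i=1}^m$ with $$\tilde c_i=c^{(0)}_i+\tfrac{1}{\sqrt m}v_c(\varphi^{(0)}_i),\quad \tilde U_i=U^{(0)}_i+\tfrac{c^{(0)}_i}{\sqrt m}v_u(\varphi^{(0)}_i),\quad \tilde W_i=W^{(0)}_i+\tfrac{c^{(0)}_i}{\sqrt m}v_w(\varphi^{(0)}_i).$$ **Lemma (approximation error).** For every $\delta\in(0,1)$, with probability at least $1-\delta$ over the initialization $\varphi^{(0)}$, $$\sup_{1\le j\le n}\big|f_{\mathrm{lin}}(X^{(j)};\tilde\varphi)-\tilde f(X^{(j)};v)\big|\;\le\;2\,(\sigma_0\bar\nu_c+\sigma_1\bar\nu_u+\sigma_1\bar\nu_w)\sqrt{\frac{2\log(2n/\delta)}{m}} .$$ In particular the bound is logarithmic in $n$ and does not depend on $T$ or $d$.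 -/

import Mathlib

open MeasureTheory ProbabilityTheory
open scoped Matrix ENNReal

noncomputable section

namespace ShallowTransformer

/-! ### Parameters -/

/-- Coordinates of the parameters `(c, U, vec W)` of one head:
one output weight, `d` hidden weights, `d * d` attention weights. -/
abbrev NeuronIdx (d : ℕ) : Type := Unit ⊕ Fin d ⊕ (Fin d × Fin d)

/-- Parameters `(c, U, vec W)` of one head, a vector of `ℝ^(1 + d + d²)` with its
Euclidean structure. -/
abbrev Neuron (d : ℕ) : Type := EuclideanSpace ℝ (NeuronIdx d)

namespace Neuron

variable {d : ℕ}

/-- Output weight `c`. -/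
def c (θ : Neuron d) : ℝ := θ (Sum.inl ())

/-- Hidden weights `U`. -/
def U (θ : Neuron d) : EuclideanSpace ℝ (Fin d) :=
  WithLp.toLp 2 fun k => θ (Sum.inr (Sum.inl k))

/-- Attention weights `W`. -/
def W (θ : Neuron d) : Matrix (Fin d) (Fin d) ℝ :=
  Matrix.of fun k l => θ (Sum.inr (Sum.inr (k, l)))

/-- The head with parameters `(c, U, vec W)`. -/
def mk (c : ℝ) (U : EuclideanSpace ℝ (Fin d)) (W : Matrix (Fin d) (Fin d) ℝ) : Neuron d :=
  WithLp.toLp 2 (Sum.elim (fun _ => c) (Sum.elim (fun k => U k) fun p => W p.1 p.2))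

@[simp] theorem c_mk (c : ℝ) (U : EuclideanSpace ℝ (Fin d)) (W : Matrix (Fin d) (Fin d) ℝ) :
    (mk c U W).c = c := rfl

@[simp] theorem U_mk (c : ℝ) (U : EuclideanSpace ℝ (Fin d)) (W : Matrix (Fin d) (Fin d) ℝ) :
    (mk c U W).U = U := rfl

@[simp] theorem W_mk (c : ℝ) (U : EuclideanSpace ℝ (Fin d)) (W : Matrix (Fin d) (Fin d) ℝ) :
    (mk c U W).W = W := rfl

end Neuron

/-- Parameters `φ = (φ₁, …, φₘ)` of the whole model, with the Euclidean structure. -/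
abbrev Params (d m : ℕ) : Type := PiLp 2 fun _ : Fin m => Neuron d

/-- Frobenius inner product `tr (Aᵀ B)`. -/
def frobInner {d : ℕ} (A B : Matrix (Fin d) (Fin d) ℝ) : ℝ := (Aᵀ * B).trace

/-- Frobenius norm. -/
def frobNorm {d : ℕ} (A : Matrix (Fin d) (Fin d) ℝ) : ℝ := √(frobInner A A)

/-! ### The model -/

/-- Inputs: sequences of `T` tokens (the columns of `X`), each of Euclidean norm at most `1`. -/
def inputSpace (d T : ℕ) : Set (Matrix (Fin d) (Fin T) ℝ) :=
  {X | ∀ t, ‖(WithLp.toLp 2 fun k => X k t : EuclideanSpace ℝ (Fin d))‖ ≤ 1}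

/-- Twice differentiable activations with uniform bounds on `σ`, `σ'`, `σ''`. -/
structure IsBoundedActivation (σ : ℝ → ℝ) (σ₀ σ₁ σ₂ : ℝ) : Prop where
  differentiable : Differentiable ℝ σ
  differentiable_deriv : Differentiable ℝ (deriv σ)
  abs_le : ∀ u, |σ u| ≤ σ₀
  abs_deriv_le : ∀ u, |deriv σ u| ≤ σ₁
  abs_deriv_deriv_le : ∀ u, |deriv (deriv σ) u| ≤ σ₂

/-- Softmax. -/
def softmax {T : ℕ} (z : Fin T → ℝ) : Fin T → ℝ :=
  fun t => Real.exp (z t) / ∑ s, Real.exp (z s)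

/-- Jacobian matrix of softmax, `diag (softmax z) - softmax z (softmax z)ᵀ`. -/
def softmaxJac {T : ℕ} (z : Fin T → ℝ) : Matrix (Fin T) (Fin T) ℝ :=
  Matrix.diagonal (softmax z) - Matrix.vecMulVec (softmax z) (softmax z)

variable {d T m : ℕ}

/-- Attention scores `Xᵀ W q`. -/
def scores (q : EuclideanSpace ℝ (Fin d)) (X : Matrix (Fin d) (Fin T) ℝ)
    (W : Matrix (Fin d) (Fin d) ℝ) : Fin T → ℝ :=
  Xᵀ *ᵥ (W *ᵥ q.ofLp)

/-- Attention layer `a(X; W) = X softmax(Xᵀ W q)`. -/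
def attn (q : EuclideanSpace ℝ (Fin d)) (X : Matrix (Fin d) (Fin T) ℝ)
    (W : Matrix (Fin d) (Fin d) ℝ) : EuclideanSpace ℝ (Fin d) :=
  WithLp.toLp 2 (X *ᵥ softmax (scores q X W))

/-- `M(X; W) = X J(Xᵀ W q) Xᵀ`, with `J` the Jacobian of softmax. -/
def attnCov (q : EuclideanSpace ℝ (Fin d)) (X : Matrix (Fin d) (Fin T) ℝ)
    (W : Matrix (Fin d) (Fin d) ℝ) : Matrix (Fin d) (Fin d) ℝ :=
  X * softmaxJac (scores q X W) * Xᵀ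

/-- Feed-forward layer `h(X; (U, W)) = σ(Uᵀ a(X; W))`. -/
def feedForward (σ : ℝ → ℝ) (q : EuclideanSpace ℝ (Fin d)) (X : Matrix (Fin d) (Fin T) ℝ)
    (θ : Neuron d) : ℝ :=
  σ (inner ℝ θ.U (attn q X θ.W))

/-- The Transformer `f(X; φ) = m^(-1/2) ∑ᵢ cᵢ h(X; θᵢ)`.
The query map `q` assigns to each input its query vector. -/
def model (σ : ℝ → ℝ) (q : Matrix (Fin d) (Fin T) ℝ → EuclideanSpace ℝ (Fin d))
    (X : Matrix (Fin d) (Fin T) ℝ) (φ : Params d m) : ℝ :=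
  1 / √(m : ℝ) * ∑ i, (φ i).c * feedForward σ (q X) X (φ i)

/-- Linearization of the model in the parameters at `φ₀`:
`f(X; φ₀) + ⟨∇f(X; φ₀), φ - φ₀⟩`. -/
def linModel (σ : ℝ → ℝ) (q : Matrix (Fin d) (Fin T) ℝ → EuclideanSpace ℝ (Fin d))
    (φ₀ : Params d m) (X : Matrix (Fin d) (Fin T) ℝ) (φ : Params d m) : ℝ :=
  model σ q X φ₀ + inner ℝ (gradient (fun ψ : Params d m => model σ q X ψ) φ₀) (φ - φ₀)

/-! ### Symmetric random initialization -/

/-- Uniform distribution on `{-1, 1}`. -/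
def rademacher : Measure ℝ :=
  (2⁻¹ : ℝ≥0∞) • Measure.dirac (-1) + (2⁻¹ : ℝ≥0∞) • Measure.dirac 1

/-- Marginal laws of the coordinates of one head: `c` is Rademacher, and every entry of `U`
and of `W` is standard Gaussian. -/
def coordLaw (d : ℕ) : NeuronIdx d → Measure ℝ
  | Sum.inl _ => rademacher
  | Sum.inr _ => gaussianReal 0 1

/-- Law of one head at initialization: all coordinates independent. -/
def neuronLaw (d : ℕ) : Measure (Neuron d) :=
  (Measure.pi (coordLaw d)).map (WithLp.toLp 2)

/-- `(c, U, W) ↦ (-c, U, W)`. -/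
def Neuron.flip (θ : Neuron d) : Neuron d := Neuron.mk (-θ.c) θ.U θ.W

theorem mirror_idx (hm : Even m) (i : Fin m) : (i : ℕ) - m / 2 < m / 2 := by
  obtain ⟨k, rfl⟩ := hm
  omega

/-- Extend `m / 2` heads to `m` heads: head `i + m / 2` is head `i` with `c` negated. -/
def mirror (hm : Even m) (θ : Fin (m / 2) → Neuron d) : Params d m :=
  WithLp.toLp 2 fun i =>
    if h : (i : ℕ) < m / 2 then θ ⟨i, h⟩
    else (θ ⟨i - m / 2, mirror_idx hm i⟩).flip

/-- Law of the symmetric initialization: the first `m / 2` heads are independent with law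
`neuronLaw d`, the others are their mirror images. -/
def symmetricInitLaw (d : ℕ) (hm : Even m) : Measure (Params d m) :=
  (Measure.pi fun _ : Fin (m / 2) => neuronLaw d).map (mirror hm)

instance : IsProbabilityMeasure rademacher := by
  constructor
  simp [rademacher, ENNReal.inv_two_add_inv_two]

instance (k : NeuronIdx d) : IsProbabilityMeasure (coordLaw d k) := by
  rcases k with k | k <;> simp only [coordLaw] <;> infer_instance

instance : IsProbabilityMeasure (neuronLaw d) :=
  Measure.isProbabilityMeasure_map (by fun_prop)

theorem Neuron.measurable_flip : Measurable (Neuron.flip (d := d)) := by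
  unfold Neuron.flip Neuron.mk Neuron.c Neuron.U Neuron.W
  refine (WithLp.measurable_toLp 2 _).comp (measurable_pi_lambda _ ?_)
  rintro (k | k | k) <;> simp <;> fun_prop

theorem measurable_mirror (hm : Even m) : Measurable (mirror (d := d) hm) := by
  unfold mirror
  refine (WithLp.measurable_toLp 2 _).comp (measurable_pi_lambda _ fun i => ?_)
  split_ifs with h
  · exact measurable_pi_apply _
  · have hi : (i : ℕ) - m / 2 < m / 2 := mirror_idx hm i
    have h2 : Measurable fun θ : Fin (m / 2) → Neuron d => θ ⟨i - m / 2, hi⟩ :=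
      measurable_pi_apply _
    exact Neuron.measurable_flip.comp h2

instance (hm : Even m) : IsProbabilityMeasure (symmetricInitLaw d hm) :=
  Measure.isProbabilityMeasure_map (measurable_mirror hm).aemeasurable

/-! ### Transportation mappings -/

/-- Random feature `φ_c(X) = σ(Uᵀ a)`. -/
def featC (σ : ℝ → ℝ) (q : EuclideanSpace ℝ (Fin d)) (X : Matrix (Fin d) (Fin T) ℝ)
    (θ : Neuron d) : ℝ :=
  σ (inner ℝ θ.U (attn q X θ.W))

/-- Random feature `φ_u(X) = σ'(Uᵀ a) a`. -/
def featU (σ : ℝ → ℝ) (q : EuclideanSpace ℝ (Fin d)) (X : Matrix (Fin d) (Fin T) ℝ)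
    (θ : Neuron d) : EuclideanSpace ℝ (Fin d) :=
  deriv σ (inner ℝ θ.U (attn q X θ.W)) • attn q X θ.W

/-- Random feature `φ_w(X) = σ'(Uᵀ a) (M U) qᵀ`. -/
def featW (σ : ℝ → ℝ) (q : EuclideanSpace ℝ (Fin d)) (X : Matrix (Fin d) (Fin T) ℝ)
    (θ : Neuron d) : Matrix (Fin d) (Fin d) ℝ :=
  deriv σ (inner ℝ θ.U (attn q X θ.W)) •
    Matrix.vecMulVec (attnCov q X θ.W *ᵥ θ.U.ofLp) q.ofLp

/-- The function `f̃(·; v)`; the expectations are over one head drawn from its initial law.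
A transportation mapping `v = (v_c, v_u, v_w)` takes the parameters of a head to a triple in
`ℝ × ℝ^d × ℝ^(d × d)`, which is again written as an element of `Neuron d`. -/
def transportFun (σ : ℝ → ℝ) (q : Matrix (Fin d) (Fin T) ℝ → EuclideanSpace ℝ (Fin d))
    (v : Neuron d → Neuron d) (X : Matrix (Fin d) (Fin T) ℝ) : ℝ :=
  (∫ θ, featC σ (q X) X θ * (v θ).c ∂neuronLaw d)
    + (∫ θ, inner ℝ (featU σ (q X) X θ) (v θ).U ∂neuronLaw d)
    + ∫ θ, frobInner (featW σ (q X) X θ) (v θ).W ∂neuronLaw d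

/-- The measurable transportation mappings with
`sup |v_c| ≤ ν_c`, `sup ‖v_u‖₂ ≤ ν_u`, `sup ‖v_w‖_F ≤ ν_w`. -/
structure IsBoundedTransport (v : Neuron d → Neuron d) (νc νu νw : ℝ) : Prop where
  measurable : Measurable v
  c_le : ∀ θ, |(v θ).c| ≤ νc
  u_le : ∀ θ, ‖(v θ).U‖ ≤ νu
  w_le : ∀ θ, frobNorm (v θ).W ≤ νw

/-- The transported parameters: `cᵢ + m^(-1/2) v_c(φᵢ)`, `Uᵢ + cᵢ m^(-1/2) v_u(φᵢ)`,
`Wᵢ + cᵢ m^(-1/2) v_w(φᵢ)`. -/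
def transported (v : Neuron d → Neuron d) (φ : Params d m) : Params d m :=
  WithLp.toLp 2 fun i =>
    Neuron.mk
      ((φ i).c + 1 / √(m : ℝ) * (v (φ i)).c)
      ((φ i).U + ((φ i).c * (1 / √(m : ℝ))) • (v (φ i)).U)
      ((φ i).W + ((φ i).c * (1 / √(m : ℝ))) • (v (φ i)).W)

end ShallowTransformer

end

open ShallowTransformer

/-!
The second half of the heads mirrors the first with the sign of `c` reversed, so `f(X; φ⁽⁰⁾) = 0`.
The transported displacement carries a factor `cᵢ` in the directions whose gradient carries the
same factor, so `cᵢ² = 1` turns the linearized model into the average over the heads of the random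
features `⟨(φ_c, φ_u, φ_w), v⟩`, whose mean is `f̃(X; v)`.

The only unbounded contribution comes from `‖M U‖`. Writing `p` for the attention weights and
`a = ∑ pₜ xₜ`, one has `M U = ∑ pₜ ⟨xₜ - a, U⟩ xₜ`, hence `‖M U‖ ≤ ∑ pₜ |⟨xₜ - a, U⟩|`. Each term is
the absolute value of a Gaussian, and `∑ pₜ ‖xₜ - a‖ ≤ 1` because the variance of the tokens under
`p` is at most `1`. The tails of `‖M U‖` are therefore no heavier than those of a standard Gaussian
on `ℝ`, whatever `d` and `T`. Hoeffding's inequality for the `m / 2` independent pairs of heads and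
a union bound over the inputs conclude.
-/

open scoped NNReal

noncomputable section

namespace ShallowTransformer

/-! ### Symmetrized sub-Gaussian variables -/

theorem convexOn_cosh : ConvexOn ℝ Set.univ Real.cosh := by
  have hexp_neg : ConvexOn ℝ Set.univ fun x : ℝ => Real.exp (-x) :=
    convexOn_exp.comp_linearMap (-LinearMap.id)
  refine ((convexOn_exp.add hexp_neg).smul (show (0 : ℝ) ≤ 2⁻¹ by norm_num)).congr fun x _ => ?_
  simp only [Pi.add_apply, smul_eq_mul, Real.cosh_eq]
  ring

/-- After multiplication by an independent random sign, `Z` is sub-Gaussian with variance proxy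
`s ^ 2`; equivalently the symmetrized moment generating function `l ↦ 𝔼[cosh (l * Z)]` is dominated
by that of `𝒩(0, s ^ 2)`. Unlike `HasSubgaussianMGF` this depends on `|Z|` only, so it needs no
centring and is inherited by dominated functions. The Lebesgue integral makes integrability part of
the bound. -/
structure HasSymmSubgaussianMGF {Ω : Type*} [MeasurableSpace Ω] (Z : Ω → ℝ) (s : ℝ)
    (μ : Measure Ω) : Prop where
  scale_nonneg : 0 ≤ s
  aemeasurable : AEMeasurable Z μ
  lintegral_cosh_le : ∀ l : ℝ,
    ∫⁻ ω, .ofReal (Real.cosh (l * Z ω)) ∂μ ≤ .ofReal (Real.exp ((l * s) ^ 2 / 2))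

namespace HasSymmSubgaussianMGF

variable {Ω Ω' : Type*} [MeasurableSpace Ω] [MeasurableSpace Ω'] {μ : Measure Ω} {ν : Measure Ω'}
  {Y Z : Ω → ℝ} {r s : ℝ}

theorem of_abs_le (hZ : HasSymmSubgaussianMGF Z s μ) (hY : AEMeasurable Y μ)
    (hYZ : ∀ ω, |Y ω| ≤ |Z ω|) : HasSymmSubgaussianMGF Y s μ where
  scale_nonneg := hZ.scale_nonneg
  aemeasurable := hY
  lintegral_cosh_le l := by
    refine (lintegral_mono fun ω => ENNReal.ofReal_le_ofReal ?_).trans (hZ.lintegral_cosh_le l)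
    rw [Real.cosh_le_cosh, abs_mul, abs_mul]
    exact mul_le_mul_of_nonneg_left (hYZ ω) (abs_nonneg l)

theorem of_bounded [IsProbabilityMeasure μ] (hZ : AEMeasurable Z μ) (hs : ∀ ω, |Z ω| ≤ s) :
    HasSymmSubgaussianMGF Z s μ := by
  have hs₀ : 0 ≤ s := have ⟨ω⟩ := μ.nonempty_of_neZero; (abs_nonneg _).trans (hs ω)
  refine ⟨hs₀, hZ, fun l => ?_⟩
  calc ∫⁻ ω, .ofReal (Real.cosh (l * Z ω)) ∂μ
      ≤ ∫⁻ _, .ofReal (Real.exp ((l * s) ^ 2 / 2)) ∂μ := by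
        refine lintegral_mono fun ω => ENNReal.ofReal_le_ofReal ?_
        refine (Real.cosh_le_cosh.2 ?_).trans (Real.cosh_le_exp_half_sq (l * s))
        rw [abs_mul, abs_mul, abs_of_nonneg hs₀]
        gcongr
        exact hs ω
    _ = .ofReal (Real.exp ((l * s) ^ 2 / 2)) := by simp

theorem congr (hZ : HasSymmSubgaussianMGF Z s μ) (hYZ : Y =ᵐ[μ] Z) :
    HasSymmSubgaussianMGF Y s μ where
  scale_nonneg := hZ.scale_nonneg
  aemeasurable := hZ.aemeasurable.congr hYZ.symm
  lintegral_cosh_le l :=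
    (lintegral_congr_ae (hYZ.mono fun ω hω => by simp only [hω])).trans_le (hZ.lintegral_cosh_le l)

theorem const_mul (hZ : HasSymmSubgaussianMGF Z s μ) (a : ℝ) :
    HasSymmSubgaussianMGF (fun ω => a * Z ω) (|a| * s) μ where
  scale_nonneg := mul_nonneg (abs_nonneg a) hZ.scale_nonneg
  aemeasurable := hZ.aemeasurable.const_mul a
  lintegral_cosh_le l := by
    have h := hZ.lintegral_cosh_le (l * a)
    simpa only [mul_assoc, mul_pow, sq_abs] using h

theorem comp_measurePreserving_iff {f : Ω' → Ω} (hf : MeasurePreserving f ν μ)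
    (hZ : AEMeasurable Z μ) :
    HasSymmSubgaussianMGF (Z ∘ f) s ν ↔ HasSymmSubgaussianMGF Z s μ := by
  have hcosh (l : ℝ) : ∫⁻ x, .ofReal (Real.cosh (l * (Z ∘ f) x)) ∂ν =
      ∫⁻ ω, .ofReal (Real.cosh (l * Z ω)) ∂μ := by
    rw [← hf.map_eq, lintegral_map' (by rw [hf.map_eq]; fun_prop) hf.aemeasurable]
    rfl
  exact ⟨fun h => ⟨h.scale_nonneg, hZ, fun l => hcosh l ▸ h.lintegral_cosh_le l⟩,
    fun h => ⟨h.scale_nonneg, hZ.comp_quasiMeasurePreserving hf.quasiMeasurePreserving,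
      fun l => (hcosh l).symm ▸ h.lintegral_cosh_le l⟩⟩

theorem prod [IsProbabilityMeasure μ] [SFinite ν] {Z : Ω × Ω' → ℝ}
    (hZ : AEMeasurable Z (μ.prod ν)) (h : ∀ x, HasSymmSubgaussianMGF (fun y => Z (x, y)) s ν) :
    HasSymmSubgaussianMGF Z s (μ.prod ν) where
  scale_nonneg := have ⟨x⟩ := μ.nonempty_of_neZero; (h x).scale_nonneg
  aemeasurable := hZ
  lintegral_cosh_le l := by
    rw [lintegral_prod _ (by fun_prop)]
    exact (lintegral_mono fun x => (h x).lintegral_cosh_le l).trans_eq (by simp)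

theorem ae_eq_zero [IsProbabilityMeasure μ] (hZ : HasSymmSubgaussianMGF Z 0 μ) : Z =ᵐ[μ] 0 := by
  have hmeas := hZ.aemeasurable
  have hcosh : (fun _ => 1) =ᵐ[μ] fun ω => ENNReal.ofReal (Real.cosh (Z ω)) := by
    refine ae_eq_of_ae_le_of_lintegral_le (.of_forall fun ω => ?_) (by simp) (by fun_prop) ?_
    · simp
    · simpa using hZ.lintegral_cosh_le 1
  filter_upwards [hcosh] with ω hω
  by_contra hne
  rw [Pi.zero_apply] at hne
  exact (Real.one_lt_cosh.2 hne).ne' (ENNReal.ofReal_eq_one.1 hω.symm)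

theorem add [IsProbabilityMeasure μ] (hY : HasSymmSubgaussianMGF Y r μ)
    (hZ : HasSymmSubgaussianMGF Z s μ) : HasSymmSubgaussianMGF (fun ω => Y ω + Z ω) (r + s) μ := by
  rcases hY.scale_nonneg.eq_or_lt with rfl | hr
  · rw [zero_add]
    exact hZ.congr (hY.ae_eq_zero.mono fun ω hω => by simp [hω])
  rcases hZ.scale_nonneg.eq_or_lt with rfl | hs
  · rw [add_zero]
    exact hY.congr (hZ.ae_eq_zero.mono fun ω hω => by simp [hω])
  have hYm := hY.aemeasurable
  have hZm := hZ.aemeasurable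
  have hconv (l : ℝ) (ω : Ω) : Real.cosh (l * (Y ω + Z ω)) ≤
      r / (r + s) * Real.cosh (l * (r + s) / r * Y ω) +
        s / (r + s) * Real.cosh (l * (r + s) / s * Z ω) := by
    have hdecomp : l * (Y ω + Z ω) = r / (r + s) * (l * (r + s) / r * Y ω) +
        s / (r + s) * (l * (r + s) / s * Z ω) := by field_simp
    rw [hdecomp]
    exact convexOn_cosh.2 (Set.mem_univ _) (Set.mem_univ _) (by positivity) (by positivity)
      (by field_simp)
  refine ⟨(add_pos hr hs).le, hYm.add hZm, fun l => ?_⟩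
  calc ∫⁻ ω, .ofReal (Real.cosh (l * (Y ω + Z ω))) ∂μ
      ≤ ∫⁻ ω, (.ofReal (r / (r + s)) * .ofReal (Real.cosh (l * (r + s) / r * Y ω)) +
          .ofReal (s / (r + s)) * .ofReal (Real.cosh (l * (r + s) / s * Z ω))) ∂μ := by
        refine lintegral_mono fun ω => (ENNReal.ofReal_le_ofReal (hconv l ω)).trans_eq ?_
        rw [ENNReal.ofReal_add (by positivity) (by positivity), ENNReal.ofReal_mul (by positivity),
          ENNReal.ofReal_mul (by positivity)]
    _ = .ofReal (r / (r + s)) * ∫⁻ ω, .ofReal (Real.cosh (l * (r + s) / r * Y ω)) ∂μ +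
          .ofReal (s / (r + s)) * ∫⁻ ω, .ofReal (Real.cosh (l * (r + s) / s * Z ω)) ∂μ := by
        rw [lintegral_add_left' (by fun_prop), lintegral_const_mul'' _ (by fun_prop),
          lintegral_const_mul'' _ (by fun_prop)]
    _ ≤ .ofReal (r / (r + s)) * .ofReal (Real.exp ((l * (r + s)) ^ 2 / 2)) +
          .ofReal (s / (r + s)) * .ofReal (Real.exp ((l * (r + s)) ^ 2 / 2)) := by
        gcongr
        · simpa [div_mul_cancel₀ _ hr.ne'] using hY.lintegral_cosh_le (l * (r + s) / r)
        · simpa [div_mul_cancel₀ _ hs.ne'] using hZ.lintegral_cosh_le (l * (r + s) / s)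
    _ = .ofReal (Real.exp ((l * (r + s)) ^ 2 / 2)) := by
        rw [← add_mul, ← ENNReal.ofReal_add (by positivity) (by positivity), ← add_div,
          div_self (by positivity), ENNReal.ofReal_one, one_mul]

theorem finsetSum [IsProbabilityMeasure μ] {ι : Type*} {t : Finset ι} {Z : ι → Ω → ℝ} {s : ι → ℝ}
    (h : ∀ i ∈ t, HasSymmSubgaussianMGF (Z i) (s i) μ) :
    HasSymmSubgaussianMGF (fun ω => ∑ i ∈ t, Z i ω) (∑ i ∈ t, s i) μ := by
  classical
  induction t using Finset.induction_on with
  | empty =>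
    simpa using of_bounded (μ := μ) (Z := fun _ => (0 : ℝ)) (s := 0) (by fun_prop) (by simp)
  | insert i t hi ih =>
    simp only [Finset.sum_insert hi]
    exact (h i (Finset.mem_insert_self i t)).add
      (ih fun k hk => h k (Finset.mem_insert_of_mem hk))

theorem mono (hZ : HasSymmSubgaussianMGF Z r μ) (hrs : r ≤ s) : HasSymmSubgaussianMGF Z s μ where
  scale_nonneg := hZ.scale_nonneg.trans hrs
  aemeasurable := hZ.aemeasurable
  lintegral_cosh_le l := by
    refine (hZ.lintegral_cosh_le l).trans (ENNReal.ofReal_le_ofReal ?_)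
    have := hZ.scale_nonneg
    simp only [mul_pow]
    gcongr

theorem integrable_cosh_mul (hZ : HasSymmSubgaussianMGF Z s μ) (l : ℝ) :
    Integrable (fun ω => Real.cosh (l * Z ω)) μ := by
  have hmeas := hZ.aemeasurable
  refine ⟨(by fun_prop : AEMeasurable _ μ).aestronglyMeasurable, ?_⟩
  rw [hasFiniteIntegral_iff_ofReal (.of_forall fun ω => (Real.cosh_pos _).le)]
  exact (hZ.lintegral_cosh_le l).trans_lt ENNReal.ofReal_lt_top

theorem integral_cosh_mul_le (hZ : HasSymmSubgaussianMGF Z s μ) (l : ℝ) :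
    ∫ ω, Real.cosh (l * Z ω) ∂μ ≤ Real.exp ((l * s) ^ 2 / 2) := by
  rw [← ENNReal.ofReal_le_ofReal_iff (Real.exp_pos _).le,
    ofReal_integral_eq_lintegral_ofReal (hZ.integrable_cosh_mul l)
      (.of_forall fun ω => (Real.cosh_pos _).le)]
  exact hZ.lintegral_cosh_le l

theorem integrable_exp_mul (hZ : HasSymmSubgaussianMGF Z s μ) (l : ℝ) :
    Integrable (fun ω => Real.exp (l * Z ω)) μ := by
  have hmeas := hZ.aemeasurable
  refine ((hZ.integrable_cosh_mul l).const_mul 2).mono'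
    (by fun_prop : AEMeasurable _ μ).aestronglyMeasurable (.of_forall fun ω => ?_)
  rw [Real.norm_of_nonneg (Real.exp_pos _).le, Real.cosh_eq]
  linarith [Real.exp_pos (-(l * Z ω))]

theorem integrable (hZ : HasSymmSubgaussianMGF Z s μ) : Integrable Z μ := by
  refine ((hZ.integrable_cosh_mul 1).const_mul 2).mono' hZ.aemeasurable.aestronglyMeasurable
    (.of_forall fun ω => ?_)
  rw [one_mul, Real.norm_eq_abs, ← Real.cosh_abs, Real.cosh_eq]
  linarith [Real.add_one_le_exp |Z ω|, Real.exp_pos (-|Z ω|)]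

theorem hasSubgaussianMGF_sub_integral [IsProbabilityMeasure μ]
    (hZ : HasSymmSubgaussianMGF Z s μ) :
    HasSubgaussianMGF (fun ω => Z ω - ∫ x, Z x ∂μ) (2 * s ^ 2).toNNReal μ := by
  have hsub (l : ℝ) (ω : Ω) : Real.exp (l * (Z ω - ∫ x, Z x ∂μ)) =
      Real.exp (l * Z ω) * Real.exp (-l * ∫ x, Z x ∂μ) := by
    rw [← Real.exp_add]
    ring_nf
  refine ⟨fun l => by simpa only [hsub] using (hZ.integrable_exp_mul l).mul_const _, fun l => ?_⟩
  have jensen : Real.exp (-l * ∫ x, Z x ∂μ) ≤ ∫ x, Real.exp (-l * Z x) ∂μ := by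
    rw [← integral_const_mul]
    exact convexOn_exp.map_integral_le Real.continuous_exp.continuousOn isClosed_univ
      (.of_forall fun _ => Set.mem_univ _) (hZ.integrable.const_mul _) (hZ.integrable_exp_mul (-l))
  have hcosh : ∫ x, Real.cosh (l * Z x) ∂μ =
      (∫ x, Real.exp (l * Z x) ∂μ + ∫ x, Real.exp (-l * Z x) ∂μ) / 2 := by
    rw [← integral_add (hZ.integrable_exp_mul l) (hZ.integrable_exp_mul (-l)), ← integral_div]
    simp only [Real.cosh_eq, neg_mul]
  calc mgf (fun ω => Z ω - ∫ x, Z x ∂μ) μ l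
      = (∫ x, Real.exp (l * Z x) ∂μ) * Real.exp (-l * ∫ x, Z x ∂μ) := by
        simp only [mgf, hsub, integral_mul_const]
    _ ≤ (∫ x, Real.exp (l * Z x) ∂μ) * ∫ x, Real.exp (-l * Z x) ∂μ := by
        gcongr
    _ ≤ (∫ x, Real.cosh (l * Z x) ∂μ) ^ 2 := by
        rw [hcosh]
        linarith [four_mul_le_sq_add (∫ x, Real.exp (l * Z x) ∂μ) (∫ x, Real.exp (-l * Z x) ∂μ)]
    _ ≤ Real.exp ((l * s) ^ 2 / 2) ^ 2 := by
        have : 0 ≤ ∫ x, Real.cosh (l * Z x) ∂μ :=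
          integral_nonneg fun x => (Real.cosh_pos (l * Z x)).le
        gcongr
        exact hZ.integral_cosh_mul_le l
    _ = _ := by
        rw [← Real.exp_nat_mul, Real.coe_toNNReal _ (by positivity)]
        congr 1
        push_cast
        ring

theorem of_hasSubgaussianMGF {c : ℝ≥0} (hZ : HasSubgaussianMGF Z c μ) :
    HasSymmSubgaussianMGF Z √c μ := by
  refine ⟨Real.sqrt_nonneg _, hZ.aemeasurable, fun l => ?_⟩
  have hcosh : (fun ω => Real.cosh (l * Z ω)) =
      fun ω => (Real.exp (l * Z ω) + Real.exp (-l * Z ω)) / 2 := by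
    funext ω
    rw [Real.cosh_eq, neg_mul]
  have hint := hZ.integrable_exp_mul
  rw [← ofReal_integral_eq_lintegral_ofReal
    (hcosh ▸ ((hint l).add (hint (-l))).div_const 2) (.of_forall fun ω => (Real.cosh_pos _).le)]
  refine ENNReal.ofReal_le_ofReal ?_
  calc ∫ ω, Real.cosh (l * Z ω) ∂μ
      = (mgf Z μ l + mgf Z μ (-l)) / 2 := by
        rw [hcosh, integral_div, integral_add (hint l) (hint (-l)), mgf, mgf]
    _ ≤ Real.exp (c * l ^ 2 / 2) := by
        linarith [hZ.mgf_le l, neg_sq l ▸ hZ.mgf_le (-l)]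
    _ = Real.exp ((l * √c) ^ 2 / 2) := by rw [mul_pow, Real.sq_sqrt c.coe_nonneg, mul_comm]

end HasSymmSubgaussianMGF

theorem measureReal_abs_gt_sqrt_le {Ω : Type*} [MeasurableSpace Ω] {μ : Measure Ω}
    [IsProbabilityMeasure μ] {Y : Ω → ℝ} {c : ℝ≥0} (hY : HasSubgaussianMGF Y c μ) {L : ℝ}
    (hL : 0 ≤ L) : μ.real {ω | √(2 * c * L) < |Y ω|} ≤ 2 * Real.exp (-L) := by
  rcases eq_or_ne c 0 with rfl | hc
  · have hzero : μ.real {ω | √(2 * (0 : ℝ≥0) * L) < |Y ω|} = 0 := by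
      rw [measureReal_eq_zero_iff, measure_eq_zero_iff_ae_notMem]
      filter_upwards [hY.ae_eq_zero_of_hasSubgaussianMGF_zero] with ω hω
      simp [hω]
    rw [hzero]
    positivity
  have upper {Y : Ω → ℝ} (hY : HasSubgaussianMGF Y c μ) :
      μ.real {ω | √(2 * c * L) ≤ Y ω} ≤ Real.exp (-L) := by
    refine (hY.measure_ge_le (Real.sqrt_nonneg _)).trans_eq ?_
    rw [Real.sq_sqrt (by positivity)]
    congr 1
    field_simp
  have hsub : {ω | √(2 * c * L) < |Y ω|} ⊆
      {ω | √(2 * c * L) ≤ Y ω} ∪ {ω | √(2 * c * L) ≤ (-Y) ω} := by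
    intro ω hω
    simp only [Set.mem_union, Set.mem_ofPred_eq, Pi.neg_apply, lt_abs] at hω ⊢
    exact hω.imp le_of_lt le_of_lt
  calc μ.real {ω | √(2 * c * L) < |Y ω|}
      ≤ μ.real {ω | √(2 * c * L) ≤ Y ω} + μ.real {ω | √(2 * c * L) ≤ (-Y) ω} :=
        (measureReal_mono hsub).trans (measureReal_union_le _ _)
    _ ≤ 2 * Real.exp (-L) := by linarith [upper hY, upper hY.neg]

theorem hasSubgaussianMGF_average {Ω : Type*} [MeasurableSpace Ω] {μ : Measure Ω}
    [IsProbabilityMeasure μ] {Y : Ω → ℝ} {c : ℝ≥0} (hY : HasSubgaussianMGF Y c μ) (N : ℕ) :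
    HasSubgaussianMGF (fun ω : Fin N → Ω => (N : ℝ)⁻¹ * ∑ i, Y (ω i)) (c / N)
      (Measure.pi fun _ => μ) := by
  have hindep : iIndepFun (fun (i : Fin N) (ω : Fin N → Ω) => Y (ω i)) (Measure.pi fun _ => μ) :=
    iIndepFun_pi fun _ => hY.aemeasurable
  have hcoord (i : Fin N) :
      HasSubgaussianMGF (fun ω : Fin N → Ω => Y (ω i)) c (Measure.pi fun _ => μ) := by
    have hmp := measurePreserving_eval (fun _ : Fin N => μ) i
    refine HasSubgaussianMGF.of_map (Y := Function.eval i) (X := Y) hmp.aemeasurable ?_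
    rwa [hmp.map_eq]
  have hsum := (HasSubgaussianMGF.sum_of_iIndepFun hindep (s := Finset.univ)
    fun i _ => hcoord i).const_mul (N : ℝ)⁻¹
  convert hsum using 1
  refine NNReal.eq ?_
  change ((c / N : ℝ≥0) : ℝ) = (N : ℝ)⁻¹ ^ 2 * (∑ _ : Fin N, c : ℝ≥0)
  simp only [Finset.sum_const, Finset.card_univ, Fintype.card_fin, nsmul_eq_mul]
  push_cast
  field_simp

theorem HasSymmSubgaussianMGF.measureReal_average_sub_integral_gt_le {Ω : Type*}
    [MeasurableSpace Ω] {μ : Measure Ω} [IsProbabilityMeasure μ] {Z : Ω → ℝ} {s : ℝ}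
    (hZ : HasSymmSubgaussianMGF Z s μ) {N : ℕ} (hN : 0 < N) {L : ℝ} (hL : 0 ≤ L) :
    (Measure.pi fun _ : Fin N => μ).real
      {ω | 2 * s * √(L / N) < |(N : ℝ)⁻¹ * ∑ i, Z (ω i) - ∫ x, Z x ∂μ|} ≤ 2 * Real.exp (-L) := by
  have hs := hZ.scale_nonneg
  have : (0 : ℝ) < N := Nat.cast_pos.2 hN
  have hthreshold : √(2 * ((2 * s ^ 2).toNNReal / N : ℝ≥0) * L) = 2 * s * √(L / N) := by
    rw [← Real.sqrt_sq (by positivity : 0 ≤ 2 * s), ← Real.sqrt_mul (sq_nonneg _)]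
    congr 1
    rw [NNReal.coe_div, Real.coe_toNNReal _ (by positivity), NNReal.coe_natCast]
    ring
  have haverage (ω : Fin N → Ω) : (N : ℝ)⁻¹ * ∑ i, (Z (ω i) - ∫ x, Z x ∂μ) =
      (N : ℝ)⁻¹ * ∑ i, Z (ω i) - ∫ x, Z x ∂μ := by
    rw [Finset.sum_sub_distrib, Finset.sum_const, Finset.card_univ, Fintype.card_fin, nsmul_eq_mul]
    field_simp
  simpa only [hthreshold, haverage] using
    measureReal_abs_gt_sqrt_le (hasSubgaussianMGF_average hZ.hasSubgaussianMGF_sub_integral N) hL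

theorem one_sub_le_measure_iSup_le {Ω ι : Type*} [MeasurableSpace Ω] [Fintype ι] [Nonempty ι]
    {P : Measure Ω} [IsProbabilityMeasure P] {Y : ι → Ω → ℝ} {b δ : ℝ}
    (h : ∀ j, P.real {ω | b < Y j ω} ≤ δ / Fintype.card ι) :
    ENNReal.ofReal (1 - δ) ≤ P {ω | ⨆ j, Y j ω ≤ b} := by
  have hbad : P.real (⋃ j, {ω | b < Y j ω}) ≤ δ := by
    refine (measureReal_iUnion_fintype_le _).trans ((Finset.sum_le_sum fun j _ => h j).trans_eq ?_)
    rw [Finset.sum_const, Finset.card_univ, nsmul_eq_mul, mul_div_cancel₀]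
    exact Nat.cast_ne_zero.2 Fintype.card_ne_zero
  have hcover : Set.univ ⊆ {ω | ⨆ j, Y j ω ≤ b} ∪ ⋃ j, {ω | b < Y j ω} := fun ω _ => by
    by_cases hω : ∃ j, b < Y j ω
    · exact .inr (Set.mem_iUnion.2 hω)
    · exact .inl (ciSup_le fun j => not_lt.1 fun hj => hω ⟨j, hj⟩)
  have hone : 1 ≤ P.real {ω | ⨆ j, Y j ω ≤ b} + P.real (⋃ j, {ω | b < Y j ω}) :=
    calc 1 = P.real Set.univ := probReal_univ.symm
      _ ≤ _ := (measureReal_mono hcover).trans (measureReal_union_le _ _)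
  rw [← ofReal_measureReal]
  exact ENNReal.ofReal_le_ofReal (by linarith)

/-! ### The gradient of the model -/

theorem inner_eq_dotProduct {ι : Type*} [Fintype ι] (x y : EuclideanSpace ℝ ι) :
    inner ℝ x y = x.ofLp ⬝ᵥ y.ofLp := by
  simp [EuclideanSpace.inner_eq_star_dotProduct, dotProduct_comm]

section Frobenius

variable {d : ℕ}

theorem frobInner_eq_sum (A B : Matrix (Fin d) (Fin d) ℝ) :
    frobInner A B = ∑ k, ∑ l, A k l * B k l := by
  simp only [frobInner, Matrix.trace, Matrix.diag, Matrix.mul_apply, Matrix.transpose_apply]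
  exact Finset.sum_comm

theorem frobInner_smul_left (r : ℝ) (A B : Matrix (Fin d) (Fin d) ℝ) :
    frobInner (r • A) B = r * frobInner A B := by
  simp [frobInner]

theorem frobInner_smul_right (r : ℝ) (A B : Matrix (Fin d) (Fin d) ℝ) :
    frobInner A (r • B) = r * frobInner A B := by
  simp [frobInner]

theorem frobInner_vecMulVec (x y : Fin d → ℝ) (B : Matrix (Fin d) (Fin d) ℝ) :
    frobInner (Matrix.vecMulVec x y) B = x ⬝ᵥ B *ᵥ y := by
  simp only [frobInner_eq_sum, Matrix.vecMulVec_apply, dotProduct, Matrix.mulVec, Finset.mul_sum]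
  exact Finset.sum_congr rfl fun k _ => Finset.sum_congr rfl fun l _ => by ring

theorem norm_mulVec_le_frobNorm (B : Matrix (Fin d) (Fin d) ℝ) (x : EuclideanSpace ℝ (Fin d)) :
    ‖(WithLp.toLp 2 (B *ᵥ x.ofLp) : EuclideanSpace ℝ (Fin d))‖ ≤ frobNorm B * ‖x‖ := by
  rw [frobNorm, EuclideanSpace.norm_eq, EuclideanSpace.norm_eq, frobInner_eq_sum,
    ← Real.sqrt_mul' _ (by positivity), Finset.sum_mul]
  refine Real.sqrt_le_sqrt (Finset.sum_le_sum fun k _ => ?_)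
  simp only [Real.norm_eq_abs, sq_abs, ← sq]
  exact Finset.sum_mul_sq_le_sq_mul_sq Finset.univ (fun l => B k l) fun l => x l

theorem abs_frobInner_vecMulVec_le (x y : EuclideanSpace ℝ (Fin d))
    (B : Matrix (Fin d) (Fin d) ℝ) :
    |frobInner (Matrix.vecMulVec x.ofLp y.ofLp) B| ≤ ‖x‖ * (frobNorm B * ‖y‖) := by
  rw [frobInner_vecMulVec]
  calc |x.ofLp ⬝ᵥ B *ᵥ y.ofLp| = |inner ℝ x (WithLp.toLp 2 (B *ᵥ y.ofLp))| := by
        rw [inner_eq_dotProduct]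
    _ ≤ ‖x‖ * ‖(WithLp.toLp 2 (B *ᵥ y.ofLp) : EuclideanSpace ℝ (Fin d))‖ :=
        abs_real_inner_le_norm _ _
    _ ≤ ‖x‖ * (frobNorm B * ‖y‖) := by
        gcongr
        exact norm_mulVec_le_frobNorm B y

theorem Neuron.inner_eq (θ ψ : Neuron d) :
    inner ℝ θ ψ = θ.c * ψ.c + inner ℝ θ.U ψ.U + frobInner θ.W ψ.W := by
  rw [inner_eq_dotProduct, inner_eq_dotProduct, frobInner_eq_sum, dotProduct,
    Fintype.sum_sum_type, Fintype.sum_sum_type, Fintype.sum_prod_type, ← add_assoc]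
  simp [Neuron.c, Neuron.U, Neuron.W, dotProduct]

end Frobenius

section Softmax

variable {T : ℕ}

theorem sum_exp_pos (z : Fin T → ℝ) (t : Fin T) : 0 < ∑ s, Real.exp (z s) :=
  Finset.sum_pos (fun _ _ => Real.exp_pos _) ⟨t, Finset.mem_univ t⟩

theorem softmax_nonneg (z : Fin T → ℝ) (t : Fin T) : 0 ≤ softmax z t :=
  div_nonneg (Real.exp_pos _).le (sum_exp_pos z t).le

theorem sum_softmax_le_one (z : Fin T → ℝ) : ∑ t, softmax z t ≤ 1 := by
  simp only [softmax, ← Finset.sum_div]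
  exact div_self_le_one _

theorem softmaxJac_mulVec (z y : Fin T → ℝ) (t : Fin T) :
    (softmaxJac z *ᵥ y) t = softmax z t * (y t - softmax z ⬝ᵥ y) := by
  simp only [softmaxJac, Matrix.sub_mulVec, Pi.sub_apply, Matrix.mulVec_diagonal,
    Matrix.vecMulVec_mulVec, Pi.smul_apply, MulOpposite.smul_eq_mul_unop, MulOpposite.unop_op]
  ring

theorem softmaxJac_transpose (z : Fin T → ℝ) : (softmaxJac z)ᵀ = softmaxJac z := by
  simp [softmaxJac, Matrix.transpose_sub, Matrix.transpose_vecMulVec]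

theorem hasFDerivAt_softmax (z : Fin T → ℝ) :
    HasFDerivAt softmax (softmaxJac z).mulVecLin.toContinuousLinearMap z := by
  refine hasFDerivAt_pi'.2 fun t => ?_
  have hexp (s : Fin T) : HasFDerivAt (fun y : Fin T → ℝ => Real.exp (y s))
      (Real.exp (z s) • ContinuousLinearMap.proj s) z := (hasFDerivAt_apply s z).exp
  have hinv := (hasDerivAt_inv (sum_exp_pos z t).ne').comp_hasFDerivAt z
    (HasFDerivAt.fun_sum (u := Finset.univ) fun s _ => hexp s)
  refine ((hexp t).mul hinv).congr_fderiv ?_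
  ext1 y
  have hmean : softmax z ⬝ᵥ y = (∑ s, Real.exp (z s) * y s) / ∑ s, Real.exp (z s) := by
    simp only [dotProduct, softmax, Finset.sum_div]
    exact Finset.sum_congr rfl fun s _ => by ring
  have hpos := sum_exp_pos z t
  simp only [neg_smul, smul_neg, Function.comp_apply, add_apply, neg_apply, smul_apply, sum_apply,
    ContinuousLinearMap.proj_apply, smul_eq_mul, LinearMap.coe_toContinuousLinearMap',
    ContinuousLinearMap.comp_apply, Matrix.mulVecBilin_apply, softmaxJac_mulVec, softmax, hmean]
  field_simp
  ring

end Softmax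

theorem hasGradientAt_sum_apply {ι : Type*} [Fintype ι] {E : ι → Type*}
    [∀ i, NormedAddCommGroup (E i)] [∀ i, InnerProductSpace ℝ (E i)] [∀ i, CompleteSpace (E i)]
    {g : ∀ i, E i → ℝ} {g' : ∀ i, E i} {x : PiLp 2 E}
    (hg : ∀ i, HasGradientAt (g i) (g' i) (x i)) :
    HasGradientAt (fun y : PiLp 2 E => ∑ i, g i (y i)) (WithLp.toLp 2 g') x := by
  have hsum := HasFDerivAt.fun_sum (u := Finset.univ) fun i _ =>
    (hg i).hasFDerivAt.comp x (PiLp.proj 2 E i : PiLp 2 E →L[ℝ] E i).hasFDerivAt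
  refine hasGradientAt_iff_hasFDerivAt.2 (hsum.congr_fderiv ?_)
  ext1 y
  simp [PiLp.inner_apply]

section Gradient

variable {d T : ℕ}

/-- The linear map `θ ↦ U`. -/
def Neuron.uCLM (d : ℕ) : Neuron d →L[ℝ] EuclideanSpace ℝ (Fin d) :=
  LinearMap.toContinuousLinearMap
    { toFun := Neuron.U
      map_add' := fun _ _ => rfl
      map_smul' := fun _ _ => rfl }

/-- The attention scores `Xᵀ W q` as a linear function of the parameters of a head. -/
def scoresCLM (q : EuclideanSpace ℝ (Fin d)) (X : Matrix (Fin d) (Fin T) ℝ) :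
    Neuron d →L[ℝ] (Fin T → ℝ) :=
  LinearMap.toContinuousLinearMap
    { toFun := fun θ => scores q X θ.W
      map_add' := fun θ ψ => by
        have hW : (θ + ψ).W = θ.W + ψ.W := rfl
        simp only [scores, hW, Matrix.add_mulVec, Matrix.mulVec_add]
      map_smul' := fun r θ => by
        have hW : (r • θ).W = r • θ.W := rfl
        simp only [scores, hW, Matrix.smul_mulVec, Matrix.mulVec_smul, RingHom.id_apply] }

variable (q : EuclideanSpace ℝ (Fin d)) (X : Matrix (Fin d) (Fin T) ℝ)

theorem hasFDerivAt_attn (θ : Neuron d) :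
    HasFDerivAt (fun θ : Neuron d => attn q X θ.W)
      ((PiLp.continuousLinearEquiv 2 ℝ fun _ : Fin d => ℝ).symm.toContinuousLinearMap ∘L
        (X * softmaxJac (scores q X θ.W)).mulVecLin.toContinuousLinearMap ∘L scoresCLM q X) θ := by
  have hsoft := (hasFDerivAt_softmax (scores q X θ.W)).comp θ (scoresCLM q X).hasFDerivAt
  have hmul := X.mulVecLin.toContinuousLinearMap.hasFDerivAt.comp θ hsoft
  have htoLp := ((PiLp.continuousLinearEquiv 2 ℝ fun _ : Fin d =>
    ℝ).symm.toContinuousLinearMap.hasFDerivAt).comp θ hmul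
  refine htoLp.congr_fderiv ?_
  ext1 ψ
  simp [Matrix.mulVec_mulVec]

theorem attnCov_transpose (W : Matrix (Fin d) (Fin d) ℝ) :
    (attnCov q X W)ᵀ = attnCov q X W := by
  simp only [attnCov, Matrix.transpose_mul, softmaxJac_transpose, Matrix.transpose_transpose,
    Matrix.mul_assoc]

theorem inner_toLp_mulVec_scores (U : EuclideanSpace ℝ (Fin d)) (W B : Matrix (Fin d) (Fin d) ℝ) :
    inner ℝ U (WithLp.toLp 2 ((X * softmaxJac (scores q X W)) *ᵥ scores q X B)) =
      frobInner (Matrix.vecMulVec (attnCov q X W *ᵥ U.ofLp) q.ofLp) B := by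
  have hscores : (X * softmaxJac (scores q X W)) *ᵥ scores q X B =
      attnCov q X W *ᵥ (B *ᵥ q.ofLp) := Matrix.mulVec_mulVec _ _ _
  rw [hscores, inner_eq_dotProduct, frobInner_vecMulVec, Matrix.dotProduct_mulVec,
    ← Matrix.mulVec_transpose, attnCov_transpose]

/-- The random features `(φ_c, φ_u, φ_w)`, gathered in one vector of `ℝ^(1 + d + d²)`, so that
`⟪feature θ, v θ⟫` is the integrand of `transportFun`. -/
def feature (σ : ℝ → ℝ) (θ : Neuron d) : Neuron d :=
  Neuron.mk (featC σ q X θ) (featU σ q X θ) (featW σ q X θ)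

variable {σ : ℝ → ℝ}

theorem hasGradientAt_feedForward (hσ : Differentiable ℝ σ) (θ : Neuron d) :
    HasGradientAt (feedForward σ q X) (Neuron.mk 0 (featU σ q X θ) (featW σ q X θ)) θ := by
  have hinner := (Neuron.uCLM d).hasFDerivAt.inner ℝ (hasFDerivAt_attn q X θ)
  have hcomp := (hσ (inner ℝ θ.U (attn q X θ.W))).hasDerivAt.comp_hasFDerivAt θ hinner
  refine hasGradientAt_iff_hasFDerivAt.2 (hcomp.congr_fderiv ?_)
  ext1 ψ
  change deriv σ (inner ℝ θ.U (attn q X θ.W)) * (inner ℝ θ.U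
    (WithLp.toLp 2 ((X * softmaxJac (scores q X θ.W)) *ᵥ scores q X ψ.W)) +
      inner ℝ ψ.U (attn q X θ.W)) = inner ℝ (Neuron.mk 0 (featU σ q X θ) (featW σ q X θ)) ψ
  rw [inner_toLp_mulVec_scores, Neuron.inner_eq]
  simp only [Neuron.c_mk, Neuron.U_mk, Neuron.W_mk, featU, featW, real_inner_smul_left,
    frobInner_smul_left, real_inner_comm (attn q X θ.W)]
  ring

theorem hasGradientAt_head (hσ : Differentiable ℝ σ) (θ : Neuron d) :
    HasGradientAt (fun θ => θ.c * feedForward σ q X θ)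
      (Neuron.mk (featC σ q X θ) (θ.c • featU σ q X θ) (θ.c • featW σ q X θ)) θ := by
  have hc : HasFDerivAt (Neuron.c (d := d))
      (PiLp.proj 2 (fun _ : NeuronIdx d => ℝ) (Sum.inl ()) : Neuron d →L[ℝ] ℝ) θ :=
    (PiLp.proj 2 (fun _ : NeuronIdx d => ℝ) (Sum.inl ())).hasFDerivAt
  refine hasGradientAt_iff_hasFDerivAt.2
    ((hc.mul (hasGradientAt_feedForward q X hσ θ).hasFDerivAt).congr_fderiv ?_)
  ext1 ψ
  change θ.c * inner ℝ (Neuron.mk 0 (featU σ q X θ) (featW σ q X θ)) ψ +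
    featC σ q X θ * ψ.c = inner ℝ (Neuron.mk _ _ _) ψ
  simp only [Neuron.inner_eq, Neuron.c_mk, Neuron.U_mk, Neuron.W_mk, real_inner_smul_left,
    frobInner_smul_left]
  ring

end Gradient

section Linearization

variable {d T m : ℕ} {σ : ℝ → ℝ} (q : Matrix (Fin d) (Fin T) ℝ → EuclideanSpace ℝ (Fin d))
  (X : Matrix (Fin d) (Fin T) ℝ)

theorem hasGradientAt_model (hσ : Differentiable ℝ σ) (φ : Params d m) :
    HasGradientAt (model σ q X) ((1 / √(m : ℝ)) • WithLp.toLp 2 fun i =>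
      Neuron.mk (featC σ (q X) X (φ i)) ((φ i).c • featU σ (q X) X (φ i))
        ((φ i).c • featW σ (q X) X (φ i))) φ := by
  have hsum := hasGradientAt_sum_apply (x := φ) fun i => hasGradientAt_head (q X) X hσ (φ i)
  rw [hasGradientAt_iff_hasFDerivAt] at hsum ⊢
  exact (hsum.const_mul (1 / √(m : ℝ))).congr_fderiv (map_smul _ _ _).symm

theorem continuous_model (hσ : Differentiable ℝ σ) :
    Continuous fun φ : Params d m => model σ q X φ :=
  continuous_iff_continuousAt.2 fun φ => (hasGradientAt_model q X hσ φ).continuousAt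

theorem transported_sub_apply (v : Neuron d → Neuron d) (φ : Params d m) (i : Fin m) :
    (transported v φ - φ) i = (1 / √(m : ℝ)) •
      Neuron.mk (v (φ i)).c ((φ i).c • (v (φ i)).U) ((φ i).c • (v (φ i)).W) := by
  ext k
  rcases k with k | k | k
  · simp [transported, Neuron.mk, Neuron.c]
  · simp only [transported, Neuron.mk, Neuron.c, Neuron.U, PiLp.sub_apply, PiLp.smul_apply,
      PiLp.add_apply, Sum.elim_inr, Sum.elim_inl, smul_eq_mul]
    ring
  · simp only [transported, Neuron.mk, Neuron.c, Neuron.W, PiLp.sub_apply, PiLp.smul_apply,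
      Matrix.add_apply, Matrix.smul_apply, Matrix.of_apply, Sum.elim_inr, smul_eq_mul]
    ring

theorem linModel_transported (hσ : Differentiable ℝ σ) (v : Neuron d → Neuron d)
    {φ : Params d m} (hc : ∀ i, (φ i).c ^ 2 = 1) :
    linModel σ q φ X (transported v φ) = model σ q X φ +
      (m : ℝ)⁻¹ * ∑ i, inner ℝ (feature (q X) X σ (φ i)) (v (φ i)) := by
  have hm : (1 / √(m : ℝ)) * (1 / √m) = (m : ℝ)⁻¹ := by
    rw [← one_div, div_mul_div_comm, Real.mul_self_sqrt m.cast_nonneg, one_mul]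
  rw [linModel, (hasGradientAt_model q X hσ φ).gradient, PiLp.inner_apply, Finset.mul_sum]
  congr 1
  refine Finset.sum_congr rfl fun i _ => ?_
  rw [transported_sub_apply, PiLp.smul_apply, real_inner_smul_left, real_inner_smul_right,
    ← mul_assoc, hm]
  simp only [real_inner_smul_left, real_inner_smul_right, Neuron.inner_eq, feature, Neuron.c_mk,
    Neuron.U_mk, Neuron.W_mk, frobInner_smul_left, frobInner_smul_right]
  linear_combination (m : ℝ)⁻¹ * (inner ℝ (featU σ (q X) X (φ i)) (v (φ i)).U +
    frobInner (featW σ (q X) X (φ i)) (v (φ i)).W) * hc i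

end Linearization

/-! ### Attention-weighted tokens -/

theorem sum_mul_norm_sub_sq_le {ι E : Type*} [Fintype ι] [NormedAddCommGroup E]
    [InnerProductSpace ℝ E] {w : ι → ℝ} (hw : ∑ i, w i ≤ 1) (x : ι → E) :
    ∑ i, w i * ‖x i - ∑ k, w k • x k‖ ^ 2 ≤ ∑ i, w i * ‖x i‖ ^ 2 := by
  set a := ∑ k, w k • x k with ha
  have hcross : ∑ i, w i * inner ℝ (x i) a = ‖a‖ ^ 2 := by
    simp only [← real_inner_smul_left, ← sum_inner, ← ha, real_inner_self_eq_norm_sq]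
  calc ∑ i, w i * ‖x i - a‖ ^ 2
      = ∑ i, w i * ‖x i‖ ^ 2 - 2 * ∑ i, w i * inner ℝ (x i) a + (∑ i, w i) * ‖a‖ ^ 2 := by
        rw [Finset.mul_sum, Finset.sum_mul, ← Finset.sum_sub_distrib, ← Finset.sum_add_distrib]
        refine Finset.sum_congr rfl fun i _ => ?_
        rw [norm_sub_sq_real]
        ring
    _ ≤ ∑ i, w i * ‖x i‖ ^ 2 := by
        rw [hcross]
        linarith [sq_nonneg ‖a‖, mul_le_mul_of_nonneg_right hw (sq_nonneg ‖a‖)]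

section Attention

variable {d T : ℕ}

/-- The `t`-th token of the input `X`, that is, its `t`-th column. -/
def token (X : Matrix (Fin d) (Fin T) ℝ) (t : Fin T) : EuclideanSpace ℝ (Fin d) :=
  WithLp.toLp 2 fun k => X k t

variable (q : EuclideanSpace ℝ (Fin d)) (X : Matrix (Fin d) (Fin T) ℝ)
  (W : Matrix (Fin d) (Fin d) ℝ)

theorem attn_eq_sum : attn q X W = ∑ t, softmax (scores q X W) t • token X t := by
  ext k
  simp [attn, token, Matrix.mulVec, dotProduct, mul_comm]

theorem transpose_mulVec_apply (U : EuclideanSpace ℝ (Fin d)) (t : Fin T) :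
    (Xᵀ *ᵥ U.ofLp) t = inner ℝ (token X t) U :=
  (inner_eq_dotProduct (token X t) U).symm

theorem attnCov_mulVec (U : EuclideanSpace ℝ (Fin d)) :
    (WithLp.toLp 2 (attnCov q X W *ᵥ U.ofLp) : EuclideanSpace ℝ (Fin d)) =
      ∑ t, (softmax (scores q X W) t * inner ℝ (token X t - attn q X W) U) • token X t := by
  have hmean : softmax (scores q X W) ⬝ᵥ (Xᵀ *ᵥ U.ofLp) = inner ℝ (attn q X W) U := by
    simp only [attn_eq_sum, sum_inner, real_inner_smul_left, dotProduct, transpose_mulVec_apply]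
  ext k
  simp only [attnCov, ← Matrix.mulVec_mulVec, WithLp.ofLp_sum, Finset.sum_apply]
  change ∑ t, X k t * _ = _
  refine Finset.sum_congr rfl fun t _ => ?_
  rw [softmaxJac_mulVec, hmean, transpose_mulVec_apply, ← inner_sub_left, mul_comm]
  rfl

theorem norm_attnCov_mulVec_le {X : Matrix (Fin d) (Fin T) ℝ} (hX : X ∈ inputSpace d T)
    (U : EuclideanSpace ℝ (Fin d)) :
    ‖(WithLp.toLp 2 (attnCov q X W *ᵥ U.ofLp) : EuclideanSpace ℝ (Fin d))‖ ≤
      ∑ t, softmax (scores q X W) t * |inner ℝ (token X t - attn q X W) U| := by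
  rw [attnCov_mulVec]
  refine norm_sum_le_of_le _ fun t _ => ?_
  rw [norm_smul, Real.norm_eq_abs, abs_mul, abs_of_nonneg (softmax_nonneg _ t)]
  exact mul_le_of_le_one_right
    (mul_nonneg (softmax_nonneg _ t) (abs_nonneg _)) (hX t)

theorem norm_attn_le_one {X : Matrix (Fin d) (Fin T) ℝ} (hX : X ∈ inputSpace d T) :
    ‖attn q X W‖ ≤ 1 := by
  rw [attn_eq_sum]
  refine (norm_sum_le_of_le _ fun t _ => ?_).trans (sum_softmax_le_one (scores q X W))
  rw [norm_smul, Real.norm_of_nonneg (softmax_nonneg _ t)]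
  exact mul_le_of_le_one_right (softmax_nonneg _ t) (hX t)

theorem sum_softmax_mul_norm_token_sub_attn_le_one {X : Matrix (Fin d) (Fin T) ℝ}
    (hX : X ∈ inputSpace d T) :
    ∑ t, softmax (scores q X W) t * ‖token X t - attn q X W‖ ≤ 1 := by
  set p := softmax (scores q X W)
  have hp : ∀ t, 0 ≤ p t := softmax_nonneg _
  have hsum : ∑ t, p t ≤ 1 := sum_softmax_le_one _
  have hvar : ∑ t, p t * ‖token X t - attn q X W‖ ^ 2 ≤ 1 := by
    rw [attn_eq_sum]
    refine (sum_mul_norm_sub_sq_le hsum (token X)).trans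
      ((Finset.sum_le_sum fun t _ => ?_).trans hsum)
    exact mul_le_of_le_one_right (hp t) (pow_le_one₀ (norm_nonneg _) (hX t))
  calc ∑ t, p t * ‖token X t - attn q X W‖
      ≤ ∑ t, (p t / 2 + p t * ‖token X t - attn q X W‖ ^ 2 / 2) := by
        refine Finset.sum_le_sum fun t _ => ?_
        have := mul_nonneg (hp t) (sq_nonneg (‖token X t - attn q X W‖ - 1))
        linarith
    _ = (∑ t, p t) / 2 + (∑ t, p t * ‖token X t - attn q X W‖ ^ 2) / 2 := by
        rw [Finset.sum_add_distrib, Finset.sum_div, Finset.sum_div]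
    _ ≤ 1 := by linarith

end Attention

section Measurability

variable {d T : ℕ} (q : EuclideanSpace ℝ (Fin d)) (X : Matrix (Fin d) (Fin T) ℝ)

@[fun_prop]
theorem continuous_neuron_c : Continuous (Neuron.c (d := d)) := by
  unfold Neuron.c
  fun_prop

@[fun_prop]
theorem continuous_neuron_U : Continuous (Neuron.U (d := d)) :=
  (Neuron.uCLM d).continuous

@[fun_prop]
theorem continuous_attn : Continuous fun θ : Neuron d => attn q X θ.W :=
  continuous_iff_continuousAt.2 fun θ => (hasFDerivAt_attn q X θ).continuousAt

theorem continuous_softmax_scores (t : Fin T) :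
    Continuous fun θ : Neuron d => softmax (scores q X θ.W) t := by
  have hsoftmax : Continuous (softmax (T := T)) :=
    continuous_iff_continuousAt.2 fun z => (hasFDerivAt_softmax z).continuousAt
  exact (continuous_apply t).comp (hsoftmax.comp (scoresCLM q X).continuous)

theorem continuous_attnCov_mulVec : Continuous fun θ : Neuron d =>
    (WithLp.toLp 2 (attnCov q X θ.W *ᵥ θ.U.ofLp) : EuclideanSpace ℝ (Fin d)) := by
  have := continuous_softmax_scores q X
  simp only [attnCov_mulVec]
  fun_prop

variable {σ : ℝ → ℝ}

theorem measurable_featC (hσ : Measurable σ) : Measurable (featC σ q X) := by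
  unfold featC
  fun_prop

theorem measurable_featU : Measurable (featU σ q X) := by
  have hinner : Measurable fun θ : Neuron d => inner ℝ θ.U (attn q X θ.W) := by fun_prop
  exact ((measurable_deriv σ).comp hinner).smul (continuous_attn q X).measurable

theorem measurable_featW_apply (k l : Fin d) : Measurable fun θ => featW σ q X θ k l := by
  have hcov : Measurable fun θ : Neuron d => (attnCov q X θ.W *ᵥ θ.U.ofLp) k :=
    ((EuclideanSpace.proj k).continuous.comp (continuous_attnCov_mulVec q X)).measurable
  have hinner : Measurable fun θ : Neuron d => inner ℝ θ.U (attn q X θ.W) := by fun_prop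
  exact ((measurable_deriv σ).comp hinner).mul (hcov.mul_const _)

end Measurability

/-! ### The attention covariance at initialization -/

theorem hasSubgaussianMGF_inner_stdGaussian {E : Type*} [NormedAddCommGroup E]
    [InnerProductSpace ℝ E] [FiniteDimensional ℝ E] [MeasurableSpace E] [BorelSpace E] (u : E) :
    HasSubgaussianMGF (fun x => inner ℝ u x) (‖u‖₊ ^ 2) (stdGaussian E) := by
  have hlaw : (stdGaussian E).map (innerSL ℝ u) = gaussianReal 0 (‖u‖₊ ^ 2) := by
    rw [IsGaussian.map_eq_gaussianReal, integral_strongDual_stdGaussian, variance_dual_stdGaussian,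
      innerSL_apply_norm]
    congr 1
    exact NNReal.eq (by simp)
  refine (HasSubgaussianMGF.id_map_iff (innerSL ℝ u).continuous.aemeasurable).1 ?_
  rw [hlaw]
  refine ⟨fun l => integrable_exp_mul_gaussianReal l, fun l => ?_⟩
  simp [mgf_id_gaussianReal]

section InitialLaw

variable {d T : ℕ}

theorem measurePreserving_toLp_neuron :
    MeasurePreserving (WithLp.toLp 2) (Measure.pi (coordLaw d)) (neuronLaw d) :=
  ⟨WithLp.measurable_toLp 2 _, rfl⟩

theorem measurePreserving_neuron_mk :
    MeasurePreserving (fun p : (ℝ × (Fin d × Fin d → ℝ)) × EuclideanSpace ℝ (Fin d) =>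
        Neuron.mk p.1.1 p.2 (Matrix.of (Function.curry p.1.2)))
      ((rademacher.prod (Measure.pi fun _ => gaussianReal 0 1)).prod (stdGaussian _))
      (neuronLaw d) := by
  have houter : MeasurePreserving (MeasurableEquiv.sumPiEquivProdPi fun _ : NeuronIdx d => ℝ).symm
      ((Measure.pi fun _ : Unit => rademacher).prod (Measure.pi fun _ => gaussianReal 0 1))
      (Measure.pi (coordLaw d)) := measurePreserving_sumPiEquivProdPi_symm (coordLaw d)
  have hinner := measurePreserving_sumPiEquivProdPi_symm (X := fun _ : Fin d ⊕ (Fin d × Fin d) => ℝ)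
    fun _ => gaussianReal 0 1
  have hU : MeasurePreserving (MeasurableEquiv.toLp 2 (Fin d → ℝ)).symm
      (stdGaussian _) (Measure.pi fun _ => gaussianReal 0 1) :=
    MeasurePreserving.symm _ ⟨WithLp.measurable_toLp 2 _, map_pi_eq_stdGaussian⟩
  have hc := (measurePreserving_funUnique rademacher Unit).symm
  have hW := MeasurePreserving.id (Measure.pi fun _ : Fin d × Fin d => gaussianReal 0 1)
  have hUW := hinner.comp (Measure.measurePreserving_swap.comp (hW.prod hU))
  exact measurePreserving_toLp_neuron.comp (houter.comp ((hc.prod hUW).comp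
    (measurePreserving_prodAssoc rademacher (Measure.pi fun _ => gaussianReal 0 1)
      (stdGaussian (EuclideanSpace ℝ (Fin d))))))

theorem hasSymmSubgaussianMGF_of_stdGaussian {Z : Neuron d → ℝ} {s : ℝ}
    (hZ : AEMeasurable Z (neuronLaw d)) (h : ∀ c W, HasSymmSubgaussianMGF
      (fun U => Z (Neuron.mk c U W)) s (stdGaussian (EuclideanSpace ℝ (Fin d)))) :
    HasSymmSubgaussianMGF Z s (neuronLaw d) := by
  have hmk := measurePreserving_neuron_mk (d := d)
  exact (HasSymmSubgaussianMGF.comp_measurePreserving_iff hmk hZ).1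
    (.prod (hZ.comp_quasiMeasurePreserving hmk.quasiMeasurePreserving)
      fun p => h p.1 (Matrix.of (Function.curry p.2)))

theorem hasSymmSubgaussianMGF_norm_attnCov_mulVec (q : EuclideanSpace ℝ (Fin d))
    {X : Matrix (Fin d) (Fin T) ℝ} (hX : X ∈ inputSpace d T) :
    HasSymmSubgaussianMGF (fun θ : Neuron d =>
      ‖(WithLp.toLp 2 (attnCov q X θ.W *ᵥ θ.U.ofLp) : EuclideanSpace ℝ (Fin d))‖) 1
      (neuronLaw d) := by
  have hmeas : Measurable fun θ : Neuron d =>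
      ‖(WithLp.toLp 2 (attnCov q X θ.W *ᵥ θ.U.ofLp) : EuclideanSpace ℝ (Fin d))‖ :=
    (continuous_attnCov_mulVec q X).norm.measurable
  refine hasSymmSubgaussianMGF_of_stdGaussian hmeas.aemeasurable fun c W => ?_
  have hterm (t : Fin T) : HasSymmSubgaussianMGF
      (fun U => softmax (scores q X W) t * |inner ℝ (token X t - attn q X W) U|)
      (softmax (scores q X W) t * ‖token X t - attn q X W‖) (stdGaussian _) := by
    have hinner := HasSymmSubgaussianMGF.of_hasSubgaussianMGF
      (hasSubgaussianMGF_inner_stdGaussian (token X t - attn q X W))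
    simpa [abs_of_nonneg (softmax_nonneg _ _)] using
      (hinner.of_abs_le (by fun_prop) fun U => (abs_abs _).le).const_mul
        (softmax (scores q X W) t)
  have hsum := HasSymmSubgaussianMGF.finsetSum (t := Finset.univ) fun t _ => hterm t
  refine (hsum.mono (sum_softmax_mul_norm_token_sub_attn_le_one q W hX)).of_abs_le
    (by simp only [Neuron.W_mk, Neuron.U_mk, attnCov_mulVec]; fun_prop) fun U => ?_
  rw [abs_norm]
  exact (norm_attnCov_mulVec_le q W hX U).trans (le_abs_self _)

end InitialLaw

/-! ### Concentration at a symmetric initialization -/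

section Features

variable {d T : ℕ} {σ : ℝ → ℝ} {σ₀ σ₁ νc νu νw : ℝ} {q : EuclideanSpace ℝ (Fin d)}
  {X : Matrix (Fin d) (Fin T) ℝ} {v : Neuron d → Neuron d}

theorem hasSymmSubgaussianMGF_featC_mul (hσ : Measurable σ) (hσ₀ : ∀ u, |σ u| ≤ σ₀)
    (hv : IsBoundedTransport v νc νu νw) :
    HasSymmSubgaussianMGF (fun θ => featC σ q X θ * (v θ).c) (σ₀ * νc) (neuronLaw d) := by
  have hmeas := (measurable_featC q X hσ).mul (continuous_neuron_c.measurable.comp hv.measurable)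
  refine .of_bounded hmeas.aemeasurable fun θ => ?_
  rw [abs_mul]
  exact mul_le_mul (hσ₀ _) (hv.c_le θ) (abs_nonneg _) ((abs_nonneg _).trans (hσ₀ 0))

theorem hasSymmSubgaussianMGF_inner_featU (hσ₁ : ∀ u, |deriv σ u| ≤ σ₁) (hX : X ∈ inputSpace d T)
    (hv : IsBoundedTransport v νc νu νw) :
    HasSymmSubgaussianMGF (fun θ => inner ℝ (featU σ q X θ) (v θ).U) (σ₁ * νu) (neuronLaw d) := by
  have hmeas := (measurable_featU q X (σ := σ)).inner (𝕜 := ℝ)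
    (continuous_neuron_U.measurable.comp hv.measurable)
  refine .of_bounded hmeas.aemeasurable fun θ => ?_
  refine (abs_real_inner_le_norm _ _).trans
    (mul_le_mul ?_ (hv.u_le θ) (norm_nonneg _) ((abs_nonneg _).trans (hσ₁ 0)))
  rw [featU, norm_smul]
  exact (mul_le_of_le_one_right (norm_nonneg _) (norm_attn_le_one q θ.W hX)).trans (hσ₁ _)

theorem measurable_frobInner_featW (hv : Measurable v) :
    Measurable fun θ => frobInner (featW σ q X θ) (v θ).W := by
  simp only [frobInner_eq_sum]
  refine Finset.measurable_fun_sum _ fun k _ => Finset.measurable_fun_sum _ fun l _ =>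
    (measurable_featW_apply q X k l).mul ?_
  unfold Neuron.W
  fun_prop

theorem hasSymmSubgaussianMGF_frobInner_featW (hσ₁ : ∀ u, |deriv σ u| ≤ σ₁) (hq : ‖q‖ ≤ 1)
    (hX : X ∈ inputSpace d T) (hv : IsBoundedTransport v νc νu νw) :
    HasSymmSubgaussianMGF (fun θ => frobInner (featW σ q X θ) (v θ).W) (σ₁ * νw)
      (neuronLaw d) := by
  have hσ₁_nonneg : 0 ≤ σ₁ := (abs_nonneg _).trans (hσ₁ 0)
  have hνw : 0 ≤ νw := (Real.sqrt_nonneg _).trans (hv.w_le 0)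
  have hcov := (hasSymmSubgaussianMGF_norm_attnCov_mulVec q hX).const_mul (σ₁ * νw)
  rw [abs_of_nonneg (by positivity), mul_one] at hcov
  refine hcov.of_abs_le (measurable_frobInner_featW hv.measurable).aemeasurable fun θ => ?_
  set MU : EuclideanSpace ℝ (Fin d) := WithLp.toLp 2 (attnCov q X θ.W *ᵥ θ.U.ofLp)
  have hvw : frobNorm (v θ).W * ‖q‖ ≤ νw :=
    (mul_le_of_le_one_right (Real.sqrt_nonneg _) hq).trans (hv.w_le θ)
  calc |frobInner (featW σ q X θ) (v θ).W|
      = |deriv σ (inner ℝ θ.U (attn q X θ.W))| *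
          |frobInner (Matrix.vecMulVec MU.ofLp q.ofLp) (v θ).W| := by
        rw [featW, frobInner_smul_left, abs_mul]
    _ ≤ σ₁ * (‖MU‖ * νw) := by
        gcongr
        · exact hσ₁ _
        · exact (abs_frobInner_vecMulVec_le MU q (v θ).W).trans (by gcongr)
    _ ≤ |σ₁ * νw * ‖MU‖| := by
        rw [mul_comm ‖MU‖, ← mul_assoc]
        exact le_abs_self _

theorem hasSymmSubgaussianMGF_inner_feature (hσ : Measurable σ) (hσ₀ : ∀ u, |σ u| ≤ σ₀)
    (hσ₁ : ∀ u, |deriv σ u| ≤ σ₁) (hq : ‖q‖ ≤ 1) (hX : X ∈ inputSpace d T)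
    (hv : IsBoundedTransport v νc νu νw) :
    HasSymmSubgaussianMGF (fun θ => inner ℝ (feature q X σ θ) (v θ))
      (σ₀ * νc + σ₁ * νu + σ₁ * νw) (neuronLaw d) := by
  simp only [Neuron.inner_eq]
  exact ((hasSymmSubgaussianMGF_featC_mul hσ hσ₀ hv).add
    (hasSymmSubgaussianMGF_inner_featU hσ₁ hX hv)).add
      (hasSymmSubgaussianMGF_frobInner_featW hσ₁ hq hX hv)

theorem measurable_inner_feature (hσ : Measurable σ) (hv : Measurable v) :
    Measurable fun θ => inner ℝ (feature q X σ θ) (v θ) := by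
  simp only [Neuron.inner_eq]
  exact (((measurable_featC q X hσ).mul (continuous_neuron_c.measurable.comp hv)).add
    ((measurable_featU q X).inner (continuous_neuron_U.measurable.comp hv))).add
      (measurable_frobInner_featW hv)

theorem integral_inner_feature {q : Matrix (Fin d) (Fin T) ℝ → EuclideanSpace ℝ (Fin d)}
    (hσ : Measurable σ) (hσ₀ : ∀ u, |σ u| ≤ σ₀)
    (hσ₁ : ∀ u, |deriv σ u| ≤ σ₁) (hq : ‖q X‖ ≤ 1) (hX : X ∈ inputSpace d T)
    (hv : IsBoundedTransport v νc νu νw) :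
    ∫ θ, inner ℝ (feature (q X) X σ θ) (v θ) ∂neuronLaw d = transportFun σ q v X := by
  have hc := hasSymmSubgaussianMGF_featC_mul (q := q X) (X := X) hσ hσ₀ hv
  have hu := hasSymmSubgaussianMGF_inner_featU (q := q X) hσ₁ hX hv
  have hw := hasSymmSubgaussianMGF_frobInner_featW hσ₁ hq hX hv
  simp only [Neuron.inner_eq]
  rw [transportFun, ← integral_add hc.integrable hu.integrable]
  exact integral_add (hc.add hu).integrable hw.integrable

end Features

section Initialization

variable {d T m : ℕ}

theorem measurePreserving_neg_rademacher :
    MeasurePreserving (fun x : ℝ => -x) rademacher rademacher := by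
  refine ⟨measurable_neg, ?_⟩
  rw [rademacher, Measure.map_add _ _ measurable_neg, Measure.map_smul, Measure.map_smul,
    Measure.map_dirac' measurable_neg, Measure.map_dirac' measurable_neg, neg_neg, add_comm]

theorem ae_sq_eq_one_rademacher : ∀ᵐ x ∂rademacher, x ^ 2 = 1 := by
  have hmeas : MeasurableSet {x : ℝ | x ^ 2 = 1} :=
    measurableSet_eq_fun (by fun_prop) measurable_const
  rw [rademacher, ae_add_measure_iff]
  exact ⟨Measure.ae_smul_measure ((ae_dirac_iff hmeas).2 (by norm_num)) _,
    Measure.ae_smul_measure ((ae_dirac_iff hmeas).2 (by norm_num)) _⟩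

theorem measurePreserving_flip :
    MeasurePreserving (Neuron.flip (d := d)) (neuronLaw d) (neuronLaw d) := by
  let f : NeuronIdx d → ℝ → ℝ := Sum.elim (fun _ x => -x) fun _ x => x
  have hf : ∀ k, MeasurePreserving (f k) (coordLaw d k) (coordLaw d k) := by
    rintro (_ | _)
    · exact measurePreserving_neg_rademacher
    · exact MeasurePreserving.id _
  have hsemi : Function.Semiconj (WithLp.toLp 2 : (NeuronIdx d → ℝ) → Neuron d)
      (fun y k => f k (y k)) Neuron.flip := fun y => by
    ext k
    rcases k with k | k | k <;> rfl
  exact measurePreserving_toLp_neuron.of_semiconj (measurePreserving_pi _ _ hf) hsemi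
    Neuron.measurable_flip

theorem ae_c_sq_eq_one : ∀ᵐ θ ∂neuronLaw d, θ.c ^ 2 = 1 := by
  have hmeas : MeasurableSet {θ : Neuron d | θ.c ^ 2 = 1} :=
    measurableSet_eq_fun (continuous_neuron_c.pow 2).measurable measurable_const
  rw [neuronLaw, ae_map_iff (by fun_prop) hmeas]
  exact (measurePreserving_eval (coordLaw d) (Sum.inl ())).quasiMeasurePreserving.ae
    ae_sq_eq_one_rademacher

theorem sum_mirror (hm : Even m) (θ : Fin (m / 2) → Neuron d) (F : Neuron d → ℝ) :
    ∑ i, F (mirror hm θ i) = ∑ i, (F (θ i) + F (θ i).flip) := by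
  have hm2 : m / 2 + m / 2 = m := by
    rw [← two_mul, Nat.two_mul_div_two_of_even hm]
  rw [← Equiv.sum_comp (finSumFinEquiv.trans (finCongr hm2)), Fintype.sum_sum_type,
    Finset.sum_add_distrib]
  simp [mirror]

theorem model_mirror (σ : ℝ → ℝ) (q : Matrix (Fin d) (Fin T) ℝ → EuclideanSpace ℝ (Fin d))
    (X : Matrix (Fin d) (Fin T) ℝ) (hm : Even m) (θ : Fin (m / 2) → Neuron d) :
    model σ q X (mirror hm θ) = 0 := by
  have hcancel (θ : Neuron d) :
      θ.c * feedForward σ (q X) X θ + θ.flip.c * feedForward σ (q X) X θ.flip = 0 := by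
    change θ.c * feedForward σ (q X) X θ + -θ.c * feedForward σ (q X) X θ = 0
    ring
  rw [model, sum_mirror hm θ fun θ => θ.c * feedForward σ (q X) X θ]
  simp [hcancel]

theorem ae_symmetricInitLaw_c_sq_eq_one (hm : Even m) :
    ∀ᵐ φ ∂symmetricInitLaw d hm, ∀ i, (φ i).c ^ 2 = 1 := by
  have hmeas : MeasurableSet {φ : Params d m | ∀ i, (φ i).c ^ 2 = 1} := by
    refine Set.ofPred_forall _ ▸ MeasurableSet.iInter fun i =>
      measurableSet_eq_fun ?_ measurable_const
    exact (by fun_prop : Continuous fun φ : Params d m => (φ i).c ^ 2).measurable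
  rw [symmetricInitLaw, ae_map_iff (measurable_mirror hm).aemeasurable hmeas]
  have hheads : ∀ᵐ θ ∂Measure.pi fun _ : Fin (m / 2) => neuronLaw d, ∀ i, (θ i).c ^ 2 = 1 :=
    ae_all_iff.2 fun i =>
      (measurePreserving_eval (fun _ : Fin (m / 2) => neuronLaw d) i).quasiMeasurePreserving.ae
        ae_c_sq_eq_one
  filter_upwards [hheads] with θ hθ i
  simp only [mirror]
  split_ifs
  · exact hθ _
  · simpa [Neuron.flip] using hθ _

theorem ae_symmetricInitLaw_model_eq_zero {σ : ℝ → ℝ} (hσ : Differentiable ℝ σ)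
    (q : Matrix (Fin d) (Fin T) ℝ → EuclideanSpace ℝ (Fin d)) (X : Matrix (Fin d) (Fin T) ℝ)
    (hm : Even m) : ∀ᵐ φ ∂symmetricInitLaw d hm, model σ q X φ = 0 := by
  have hmeas : MeasurableSet {φ : Params d m | model σ q X φ = 0} :=
    measurableSet_eq_fun (continuous_model q X hσ).measurable measurable_const
  rw [symmetricInitLaw, ae_map_iff (measurable_mirror hm).aemeasurable hmeas]
  exact .of_forall (model_mirror σ q X hm)

theorem ae_linModel_transported {σ : ℝ → ℝ} (hσ : Differentiable ℝ σ)
    (q : Matrix (Fin d) (Fin T) ℝ → EuclideanSpace ℝ (Fin d)) (X : Matrix (Fin d) (Fin T) ℝ)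
    (v : Neuron d → Neuron d) (hm : Even m) :
    ∀ᵐ φ ∂symmetricInitLaw d hm, linModel σ q φ X (transported v φ) =
      (m : ℝ)⁻¹ * ∑ i, inner ℝ (feature (q X) X σ (φ i)) (v (φ i)) := by
  filter_upwards [ae_symmetricInitLaw_c_sq_eq_one hm,
    ae_symmetricInitLaw_model_eq_zero hσ q X hm] with φ hc hzero
  rw [linModel_transported q X hσ v hc, hzero, zero_add]

theorem measureReal_average_symmetricInitLaw_gt_le {Z : Neuron d → ℝ} {s : ℝ} (hZm : Measurable Z)
    (hZ : HasSymmSubgaussianMGF Z s (neuronLaw d)) (hm : Even m) (hm_pos : 0 < m) {L : ℝ}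
    (hL : 0 ≤ L) :
    (symmetricInitLaw d hm).real
      {φ | 2 * s * √(2 * L / m) < |(m : ℝ)⁻¹ * ∑ i, Z (φ i) - ∫ θ, Z θ ∂neuronLaw d|} ≤
      2 * Real.exp (-L) := by
  have hm2 : 2 * (m / 2) = m := Nat.two_mul_div_two_of_even hm
  have hmR : (m : ℝ) = 2 * (m / 2 : ℕ) := by exact_mod_cast hm2.symm
  have hflip : HasSymmSubgaussianMGF (fun θ => Z θ.flip) s (neuronLaw d) :=
    (HasSymmSubgaussianMGF.comp_measurePreserving_iff measurePreserving_flip hZ.aemeasurable).2 hZ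
  have hpair := (hZ.add hflip).const_mul 2⁻¹
  have hscale : |(2⁻¹ : ℝ)| * (s + s) = s := by
    rw [abs_of_pos (by norm_num)]
    ring
  have hintegral : ∫ θ, 2⁻¹ * (Z θ + Z θ.flip) ∂neuronLaw d = ∫ θ, Z θ ∂neuronLaw d := by
    have hmap : ∫ θ, Z θ.flip ∂neuronLaw d = ∫ θ, Z θ ∂neuronLaw d := by
      conv_rhs => rw [← measurePreserving_flip.map_eq]
      exact (integral_map Neuron.measurable_flip.aemeasurable hZm.aestronglyMeasurable).symm
    rw [integral_const_mul, integral_add hZ.integrable hflip.integrable, hmap]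
    ring
  have haverage (θ : Fin (m / 2) → Neuron d) : (m : ℝ)⁻¹ * ∑ i, Z (mirror hm θ i) =
      ((m / 2 : ℕ) : ℝ)⁻¹ * ∑ i, 2⁻¹ * (Z (θ i) + Z (θ i).flip) := by
    rw [sum_mirror, ← Finset.mul_sum, ← mul_assoc, hmR, mul_inv, mul_comm (2⁻¹ : ℝ)]
  have hthreshold : 2 * L / m = L / (m / 2 : ℕ) := by
    rw [hmR, mul_div_mul_left _ _ two_ne_zero]
  have hmeas : MeasurableSet {φ : Params d m |
      2 * s * √(2 * L / m) < |(m : ℝ)⁻¹ * ∑ i, Z (φ i) - ∫ θ, Z θ ∂neuronLaw d|} :=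
    measurableSet_lt measurable_const (by fun_prop)
  rw [symmetricInitLaw, map_measureReal_apply (measurable_mirror hm) hmeas, Set.preimage_ofPred_eq]
  simpa only [haverage, hthreshold, hscale, hintegral] using
    hpair.measureReal_average_sub_integral_gt_le (by omega : 0 < m / 2) hL

end Initialization

section Approximation

variable {d T m : ℕ} {σ : ℝ → ℝ} {σ₀ σ₁ νc νu νw : ℝ} {v : Neuron d → Neuron d}

theorem measureReal_linModel_sub_transportFun_gt_le (hm : Even m) (hm_pos : 0 < m)
    (hσ : Differentiable ℝ σ) (hσ₀ : ∀ u, |σ u| ≤ σ₀) (hσ₁ : ∀ u, |deriv σ u| ≤ σ₁)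
    {q : Matrix (Fin d) (Fin T) ℝ → EuclideanSpace ℝ (Fin d)} {X : Matrix (Fin d) (Fin T) ℝ}
    (hq : ‖q X‖ ≤ 1) (hX : X ∈ inputSpace d T) (hv : IsBoundedTransport v νc νu νw)
    {Ω : Type*} [MeasurableSpace Ω] {P : Measure Ω} {φ₀ : Ω → Params d m}
    (hφ₀ : HasLaw φ₀ (symmetricInitLaw d hm) P) {L : ℝ} (hL : 0 ≤ L) :
    P.real {ω | 2 * (σ₀ * νc + σ₁ * νu + σ₁ * νw) * √(2 * L / m) <
      |linModel σ q (φ₀ ω) X (transported v (φ₀ ω)) - transportFun σ q v X|} ≤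
      2 * Real.exp (-L) := by
  have hσm := hσ.continuous.measurable
  have hZm := measurable_inner_feature (q := q X) (X := X) hσm hv.measurable
  have hdev := measureReal_average_symmetricInitLaw_gt_le hZm
    (hasSymmSubgaussianMGF_inner_feature hσm hσ₀ hσ₁ hq hX hv) hm hm_pos hL
  rw [integral_inner_feature hσm hσ₀ hσ₁ hq hX hv] at hdev
  have hlin := ae_of_ae_map hφ₀.aemeasurable
    (hφ₀.map_eq.symm ▸ ae_linModel_transported hσ q X v hm)
  have havg : Measurable fun φ : Params d m =>
      (m : ℝ)⁻¹ * ∑ i, inner ℝ (feature (q X) X σ (φ i)) (v (φ i)) :=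
    (Finset.measurable_fun_sum _ fun i _ =>
      hZm.comp (by fun_prop : Measurable fun φ : Params d m => φ i)).const_mul _
  have hbad := hφ₀.measureReal_eq (p := fun φ =>
    2 * (σ₀ * νc + σ₁ * νu + σ₁ * νw) * √(2 * L / m) <
      |(m : ℝ)⁻¹ * ∑ i, inner ℝ (feature (q X) X σ (φ i)) (v (φ i)) - transportFun σ q v X|)
    (measurableSet_lt measurable_const (havg.sub_const _).abs)
  refine (measureReal_congr ?_).trans_le (hbad.trans_le hdev)
  filter_upwards [hlin] with ω hω
  change (_ < |_ - _|) = (_ < |_|)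
  rw [hω]

end Approximation

end ShallowTransformer

end

open ShallowTransformer

theorem mainTheorem3_general {ι : Type*} [Fintype ι] [Nonempty ι] {d T m : ℕ} (hm : Even m)
    (hm_pos : 0 < m) {σ : ℝ → ℝ} {σ₀ σ₁ : ℝ} (hσ : Differentiable ℝ σ) (hσ₀ : ∀ u, |σ u| ≤ σ₀)
    (hσ₁ : ∀ u, |deriv σ u| ≤ σ₁) (q : Matrix (Fin d) (Fin T) ℝ → EuclideanSpace ℝ (Fin d))
    (X : ι → Matrix (Fin d) (Fin T) ℝ) (hq : ∀ j, ‖q (X j)‖ ≤ 1)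
    (hX : ∀ j, X j ∈ inputSpace d T)
    {νc νu νw : ℝ} (v : Neuron d → Neuron d) (hv : IsBoundedTransport v νc νu νw)
    {Ω : Type*} [MeasurableSpace Ω] (P : Measure Ω) [IsProbabilityMeasure P]
    (φ₀ : Ω → Params d m) (hφ₀ : HasLaw φ₀ (symmetricInitLaw d hm) P)
    {δ : ℝ} (hδ : δ ∈ Set.Ioo (0 : ℝ) 1) :
    ENNReal.ofReal (1 - δ) ≤
      P {ω | (⨆ j,
          |linModel σ q (φ₀ ω) (X j) (transported v (φ₀ ω)) - transportFun σ q v (X j)|) ≤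
        2 * (σ₀ * νc + σ₁ * νu + σ₁ * νw) *
          √(2 * Real.log (2 * Fintype.card ι / δ) / m)} := by
  have hcard : (1 : ℝ) ≤ Fintype.card ι := Nat.one_le_cast.2 Fintype.card_pos
  have hratio : 1 ≤ 2 * Fintype.card ι / δ := by
    rw [one_le_div hδ.1]
    linarith [hδ.2]
  refine one_sub_le_measure_iSup_le fun j => ?_
  calc P.real {ω | _ < |linModel σ q (φ₀ ω) (X j) (transported v (φ₀ ω)) -
          transportFun σ q v (X j)|}
      ≤ 2 * Real.exp (-Real.log (2 * Fintype.card ι / δ)) :=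
        measureReal_linModel_sub_transportFun_gt_le hm hm_pos hσ hσ₀ hσ₁ (hq j) (hX j) hv hφ₀
          (Real.log_nonneg hratio)
    _ = δ / Fintype.card ι := by
        rw [Real.exp_neg, Real.exp_log (by linarith)]
        field_simp

theorem mainTheorem3 {d T m n : ℕ} (hm : Even m) (hm_pos : 0 < m) (hn : 0 < n)
    {σ : ℝ → ℝ} {σ₀ σ₁ σ₂ : ℝ} (hσ : IsBoundedActivation σ σ₀ σ₁ σ₂)
    (q : Matrix (Fin d) (Fin T) ℝ → EuclideanSpace ℝ (Fin d))
    (hq : ∀ X ∈ inputSpace d T, ‖q X‖ ≤ 1)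
    (X : Fin n → Matrix (Fin d) (Fin T) ℝ) (hX : ∀ j, X j ∈ inputSpace d T)
    {νc νu νw : ℝ} (v : Neuron d → Neuron d) (hv : IsBoundedTransport v νc νu νw)
    {Ω : Type*} [MeasurableSpace Ω] (P : Measure Ω) [IsProbabilityMeasure P]
    (φ₀ : Ω → Params d m) (hφ₀ : HasLaw φ₀ (symmetricInitLaw d hm) P)
    {δ : ℝ} (hδ : δ ∈ Set.Ioo (0 : ℝ) 1) :
    ENNReal.ofReal (1 - δ) ≤
      P {ω | (⨆ j : Fin n,
          |linModel σ q (φ₀ ω) (X j) (transported v (φ₀ ω)) - transportFun σ q v (X j)|) ≤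
        2 * (σ₀ * νc + σ₁ * νu + σ₁ * νw) * √(2 * Real.log (2 * n / δ) / m)} := by
  have : Nonempty (Fin n) := ⟨⟨0, hn⟩⟩
  simpa only [Fintype.card_fin] using mainTheorem3_general hm hm_pos hσ.differentiable hσ.abs_le
    hσ.abs_deriv_le q X (fun j => hq _ (hX j)) hX v hv P φ₀ hφ₀ hδ
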